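/- For permutations $\pi\in S_m$, $\sigma\in S_n$ let $\pi\oplus\sigma$ (resp. $\pi\ominus\sigma$) be the permutation of length $m+n$ obtained by writing $\pi$ followed by $\sigma$ with all entries of $\sigma$ increased by $m$ (resp. with all entries of $\pi$ increased by $n$). The separable permutations are those built from the permutation $1$ by repeatedly applying $\oplus$ and $\ominus$. A nonempty permutation $\pi_1\cdots\pi_n$ is reducible if for some $2\le i\le n$ every element of $\pi_1\cdots\pi_{i-1}$ is less than every element of $\pi_i\cdots\pi_n$, and irreducible otherwise. Let $\mathrm{lmax},\mathrm{rmax},\mathrm{lmin},\mathrm{rmin}$ be the numbers of left-to-right maxima, right-to-left maxima, left-to-right minima and right-to-left minima. Put $$S(t,x,y,u,v)=\sum_{\pi}t^{|\pi|}x^{\mathrm{lmax}(\pi)}y^{\mathrm{rmax}(\pi)}u^{\mathrm{lmin}(\pi)}v^{\mathrm{rmin}(\pi)},$$ a formal power series in $t$, the sum being over all separable permutations, and let $I(t,x,y,u,v)$ and $R(t,x,y,u,v)$ be the same sums over the irreducible and the reducible separable permutations, respectively. Let $$s(z)=\frac{4\sqrt{\left(-\frac14\sqrt{t^2-6t+1}-tz+\frac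 t4+\frac54\right)^2+\sqrt{t^2-6t+1}-t-1}-\sqrt{t^2-6t+1}+4tz+t-3}{2\left(\sqrt{t^2-6t+1}-t-1\right)},$$ where both square roots are the power series in $t$ with constant term $1$, and let $$E(t,z_1,z_2,z_3)=z_1z_2z_3t+\frac{(s(z_1)+1)(s(z_2)+1)(s(z_3)+1)\,t^2z_1^2z_2z_3}{(1-s(z_1)s(z_3))(1-s(z_1)s(z_2))},\qquad A(z_2,z_3)=s(z_2)\left(z_3t+\frac{s(z_3)^2}{s(z_3)+1}\right).$$ Then $$S(t,x,y,u,v)=xyuvt+E(t,x,y,u)\,S(t,1,y,u,v)+E(t,y,x,v)\,S(t,x,1,u,v),$$ $$I(t,x,y,u,v)=xyuvt+E(t,x,y,u)\,S(t,1,y,u,v),\qquad R(t,x,y,u,v)=E(t,y,x,v)\,S(t,x,1,u,v).$$ Here the generating functions of three statistics are $$S(t,1,y,u,v)=\frac{E(t,v,y,u)}{1-A(y,u)-tyu},\qquad S(t,x,1,u,v)=\frac{E(t,u,v,x)}{1-A(v,x)-tvx},$$ and $s$ is the generating function of each single statistic: $S(t,x,1,1,1)=s(x)$, $S(t,1,y,1,1)=s(y)$,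 $S(t,1,1,u,1)=s(u)$, $S(t,1,1,1,v)=s(v)$. -/

import Mathlib

namespace SepPerm

open Equiv

/-! ### Permutations, sums, separability, irreducibility

A permutation of length `n` is an element of `Equiv.Perm (Fin n)`; positions and values are
numbered from `0`. -/

/-- The direct sum `π ⊕ σ`: first `π`, then `σ` shifted up by the length of `π`. -/
def directSum {m n : ℕ} (π : Perm (Fin m)) (σ : Perm (Fin n)) : Perm (Fin (m + n)) :=
  finSumFinEquiv.permCongr (Perm.sumCongr π σ)

/-- The skew sum `π ⊖ σ`: first `π` shifted up by the length of `σ`, then `σ`. -/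
def skewSum {m n : ℕ} (π : Perm (Fin m)) (σ : Perm (Fin n)) : Perm (Fin (m + n)) :=
  (finSumFinEquiv.symm.trans (Perm.sumCongr π σ)).trans
    ((Equiv.sumComm (Fin m) (Fin n)).trans
      (finSumFinEquiv.trans (finCongr (Nat.add_comm n m))))

theorem directSum_castAdd {m n : ℕ} (π : Perm (Fin m)) (σ : Perm (Fin n)) (i : Fin m) :
    (directSum π σ (Fin.castAdd n i) : ℕ) = π i := by
  simp [directSum, Equiv.permCongr_apply]

theorem directSum_natAdd {m n : ℕ} (π : Perm (Fin m)) (σ : Perm (Fin n)) (i : Fin n) :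
    (directSum π σ (Fin.natAdd m i) : ℕ) = σ i + m := by
  simp [directSum, Equiv.permCongr_apply, Nat.add_comm]

theorem skewSum_castAdd {m n : ℕ} (π : Perm (Fin m)) (σ : Perm (Fin n)) (i : Fin m) :
    (skewSum π σ (Fin.castAdd n i) : ℕ) = π i + n := by
  simp [skewSum, Nat.add_comm]

theorem skewSum_natAdd {m n : ℕ} (π : Perm (Fin m)) (σ : Perm (Fin n)) (i : Fin n) :
    (skewSum π σ (Fin.natAdd m i) : ℕ) = σ i := by
  simp [skewSum]

/-- The separable permutations: those built from the permutation of length one by repeatedly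
applying direct sums and skew sums. The empty permutation is not separable. -/
inductive IsSeparable : ∀ {n : ℕ}, Perm (Fin n) → Prop
  | one : IsSeparable (1 : Perm (Fin 1))
  | sum {m n : ℕ} {π : Perm (Fin m)} {σ : Perm (Fin n)} :
      IsSeparable π → IsSeparable σ → IsSeparable (directSum π σ)
  | skew {m n : ℕ} {π : Perm (Fin m)} {σ : Perm (Fin n)} :
      IsSeparable π → IsSeparable σ → IsSeparable (skewSum π σ)

/-- A nonempty permutation is irreducible if it cannot be cut into two nonempty parts such that
every entry of the first part is less than every entry of the second part. -/
def IsIrreducible {n : ℕ} (π : Perm (Fin n)) : Prop :=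
  0 < n ∧ ¬ ∃ k : ℕ, 0 < k ∧ k < n ∧
    ∀ i j : Fin n, (i : ℕ) < k → k ≤ (j : ℕ) → π i < π j

/-- A nonempty permutation is reducible if it is not irreducible. -/
def IsReducible {n : ℕ} (π : Perm (Fin n)) : Prop :=
  0 < n ∧ ¬ IsIrreducible π

/-! ### The four statistics -/

/-- The number of left-to-right maxima. -/
def lmax {n : ℕ} (π : Perm (Fin n)) : ℕ :=
  (Finset.univ.filter fun i : Fin n => ∀ j : Fin n, j < i → π j < π i).card

/-- The number of right-to-left maxima. -/
def rmax {n : ℕ} (π : Perm (Fin n)) : ℕ :=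
  (Finset.univ.filter fun i : Fin n => ∀ j : Fin n, i < j → π j < π i).card

/-- The number of left-to-right minima. -/
def lmin {n : ℕ} (π : Perm (Fin n)) : ℕ :=
  (Finset.univ.filter fun i : Fin n => ∀ j : Fin n, j < i → π i < π j).card

/-- The number of right-to-left minima. -/
def rmin {n : ℕ} (π : Perm (Fin n)) : ℕ :=
  (Finset.univ.filter fun i : Fin n => ∀ j : Fin n, i < j → π i < π j).card

/-! ### Generating functions

Generating functions are formal power series in `t` whose coefficients are polynomials in the
indeterminates `x`, `y`, `u`, `v`; rational expressions in them live in the field of fractions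
of this ring of power series (an integral domain). -/

/-- The ring of coefficients `ℚ[x, y, u, v]`. -/
abbrev Coef : Type := MvPolynomial (Fin 4) ℚ

/-- The field of fractions of `ℚ[x, y, u, v]⟦t⟧`. -/
abbrev GFField : Type := FractionRing (PowerSeries Coef)

noncomputable section

/-- The indeterminate marking left-to-right maxima. -/
def x : Coef := MvPolynomial.X 0
/-- The indeterminate marking right-to-left maxima. -/
def y : Coef := MvPolynomial.X 1
/-- The indeterminate marking left-to-right minima. -/
def u : Coef := MvPolynomial.X 2
/-- The indeterminate marking right-to-left minima. -/
def v : Coef := MvPolynomial.X 3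

/-- The (injective) inclusion of power series into the field of fractions. -/
def emb : PowerSeries Coef →+* GFField := algebraMap (PowerSeries Coef) GFField

/-- The series variable `t`, as an element of the field of fractions. -/
def t : GFField := emb PowerSeries.X

/-- A coefficient, as an element of the field of fractions. -/
def cst (z : Coef) : GFField := emb (PowerSeries.C z)

open scoped Classical in
/-- The generating function `∑ t^|π| a^lmax(π) b^rmax(π) c^lmin(π) d^rmin(π)`, the sum being
over all permutations `π` with the property `P`. -/
def genFun (P : ∀ {n : ℕ}, Perm (Fin n) → Prop) (a b c d : Coef) : GFField :=
  emb (PowerSeries.mk fun n =>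
    ∑ π ∈ Finset.univ.filter (fun π : Perm (Fin n) => P π),
      a ^ lmax π * b ^ rmax π * c ^ lmin π * d ^ rmin π)

/-- Generating function of separable permutations. A statistic is forgotten by setting its
variable to `1`. -/
def sepGF (a b c d : Coef) : GFField := genFun (fun π => IsSeparable π) a b c d

/-- Generating function of irreducible separable permutations. -/
def irrGF (a b c d : Coef) : GFField :=
  genFun (fun π => IsSeparable π ∧ IsIrreducible π) a b c d

/-- Generating function of reducible separable permutations. -/
def redGF (a b c d : Coef) : GFField :=
  genFun (fun π => IsSeparable π ∧ IsReducible π) a b c d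

/-! ### Square roots of power series -/

/-- The coefficients of the square root with constant term `1`, computed recursively. -/
def sqrtCoeff (f : PowerSeries Coef) : ℕ → Coef
  | 0 => 1
  | n + 1 => (1 / 2 : ℚ) • (PowerSeries.coeff (n + 1) f -
      ∑ i : Fin n, sqrtCoeff f (i + 1) * sqrtCoeff f (n - i))
  decreasing_by all_goals omega

/-- The square root of a power series `f` with constant term `1`: the unique power series with
constant term `1` whose square is `f` (see the two facts below). -/
def psqrt (f : PowerSeries Coef) : PowerSeries Coef := PowerSeries.mk (sqrtCoeff f)

theorem constantCoeff_psqrt (f : PowerSeries Coef) :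
    PowerSeries.constantCoeff (psqrt f) = 1 := by
  rw [← PowerSeries.coeff_zero_eq_constantCoeff_apply, psqrt, PowerSeries.coeff_mk, sqrtCoeff]

theorem psqrt_sq (f : PowerSeries Coef) (hf : PowerSeries.constantCoeff f = 1) :
    psqrt f ^ 2 = f := by
  ext1 n
  rw [sq, PowerSeries.coeff_mul]
  simp only [psqrt, PowerSeries.coeff_mk]
  rw [Finset.Nat.sum_antidiagonal_eq_sum_range_succ
    (fun i j => sqrtCoeff f i * sqrtCoeff f j)]
  cases n with
  | zero => simp [sqrtCoeff, hf]
  | succ n =>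
    have h0 : sqrtCoeff f 0 = 1 := by rw [sqrtCoeff]
    have h1 : sqrtCoeff f (n + 1) + sqrtCoeff f (n + 1) = PowerSeries.coeff (n + 1) f -
        ∑ i ∈ Finset.range n, sqrtCoeff f (i + 1) * sqrtCoeff f (n - i) := by
      rw [Finset.sum_range fun i => sqrtCoeff f (i + 1) * sqrtCoeff f (n - i), sqrtCoeff,
        ← add_smul]
      norm_num
    rw [Finset.sum_range_succ, Finset.sum_range_succ']
    simp only [h0, Nat.sub_self, Nat.sub_zero, Nat.add_sub_add_right]
    linear_combination h1

theorem eq_psqrt (f g : PowerSeries Coef) (hg : PowerSeries.constantCoeff g = 1)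
    (h : g ^ 2 = f) : g = psqrt f := by
  have hf : PowerSeries.constantCoeff f = 1 := by rw [← h, map_pow, hg, one_pow]
  have h2 : (g - psqrt f) * (g + psqrt f) = 0 := by
    linear_combination h - psqrt_sq f hf
  rcases mul_eq_zero.1 h2 with h3 | h3
  · exact sub_eq_zero.1 h3
  · have h4 := congrArg PowerSeries.constantCoeff h3
    rw [map_add, hg, constantCoeff_psqrt, map_zero, one_add_one_eq_two] at h4
    exact absurd h4 two_ne_zero

/-! ### The explicit formulas -/

/-- The power series `√(t² - 6t + 1)`. -/
def rootA : PowerSeries Coef := psqrt (PowerSeries.X ^ 2 - 6 * PowerSeries.X + 1)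

/-- The power series `√((-¼√(t² - 6t + 1) - tz + t/4 + 5/4)² + √(t² - 6t + 1) - t - 1)`. -/
def rootB (z : Coef) : PowerSeries Coef :=
  psqrt ((-((1 / 4 : ℚ) • rootA) - PowerSeries.X * PowerSeries.C z
      + (1 / 4 : ℚ) • PowerSeries.X + (5 / 4 : ℚ) • 1) ^ 2 + rootA - PowerSeries.X - 1)

/-- The closed form `S(t, z)` for the distribution of one statistic. -/
def S1 (z : Coef) : GFField :=
  (4 * emb (rootB z) - emb rootA + 4 * t * cst z + t - 3) / (2 * (emb rootA - t - 1))

/-- The function `E(t, z₁, z₂, z₃)`. -/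
def E (z₁ z₂ z₃ : Coef) : GFField :=
  cst z₁ * cst z₂ * cst z₃ * t +
    (S1 z₁ + 1) * (S1 z₂ + 1) * (S1 z₃ + 1) * t ^ 2 * cst z₁ ^ 2 * cst z₂ * cst z₃ /
      ((1 - S1 z₁ * S1 z₃) * (1 - S1 z₁ * S1 z₂))

/-- The function `A(z₂, z₃)`. -/
def A (z₂ z₃ : Coef) : GFField :=
  S1 z₂ * (cst z₃ * t + S1 z₃ ^ 2 / (S1 z₃ + 1))

/-- The closed form `E(t, z₁, z₂, z₃) / (1 - A(z₂, z₃) - t z₂ z₃)` for the distribution of three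
statistics. -/
def S3 (z₁ z₂ z₃ : Coef) : GFField :=
  E z₁ z₂ z₃ / (1 - A z₂ z₃ - t * cst z₂ * cst z₃)

end

end SepPerm

/-! Write S, I, R for the generating functions of all, irreducible and reducible separable
permutations. Two facts suffice. A reducible separable permutation is uniquely a separable one ⊕ an
irreducible separable one, and `lmax`, `rmin` add under ⊕ while `rmax` sees only the right summand
and `lmin` only the left: R(a,b,c,d) = S(a,1,c,d) I(a,b,1,d) (`redSeries_eq_mul`). Reversal
exchanges the variables a, b and c, d, and exchanges irreducible and reducible separable
permutations of length at least 2: I(b,a,d,c) = abcd t + R(a,b,c,d) (`irrSeries_eq`). Together with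
S = I + R they give I(a,b,c,d) = abcd t + (abc t + R(a,b,c,1)) S(1,b,c,d) (`irrGF_eq_add_mul`).
Setting variables to 1 then determines everything in turn: a quadratic for S(1,1,1,1), a quadratic
over it for each single statistic, and linear equations for two and three statistics. The bracket
above is E(a,b,c), so the theorem follows. -/

namespace SepPerm

open Equiv

/-! ### Statistics of direct sums -/

section DirectSum

variable {m n : ℕ} (π : Perm (Fin m)) (σ : Perm (Fin n))

theorem forall_fin_add {P : Fin (m + n) → Prop} :
    (∀ j, P j) ↔ (∀ j, P (Fin.castAdd n j)) ∧ ∀ j, P (Fin.natAdd m j) :=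
  ⟨fun h => ⟨fun _ => h _, fun _ => h _⟩, fun h j => Fin.addCases h.1 h.2 j⟩

/-- Every entry of `π` lies to the left of and below every entry of `σ`, so neither block obstructs
the left-to-right maxima or right-to-left minima of the other. For `rmax` any entry of `σ`
disqualifies all of `π`, and dually for `lmin`; hence the nonemptiness hypotheses there. -/
theorem lmax_directSum : lmax (directSum π σ) = lmax π + lmax σ := by
  simp only [lmax, Finset.card_filter, Fin.sum_univ_add, forall_fin_add, Fin.lt_def,
    directSum_castAdd, directSum_natAdd, Fin.val_castAdd, Fin.val_natAdd]
  congr 1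
  · refine Finset.sum_congr rfl fun i _ => if_congr ⟨fun h => h.1, fun h => ⟨h, ?_⟩⟩ rfl rfl
    intro j hj
    omega
  · refine Finset.sum_congr rfl fun i _ => if_congr ⟨fun h j hj => ?_, fun h => ⟨?_, ?_⟩⟩ rfl rfl
    · have := h.2 j (by omega)
      omega
    · intro j _
      have := (π j).isLt
      omega
    · intro j hj
      have := h j (by omega)
      omega

theorem rmin_directSum : rmin (directSum π σ) = rmin π + rmin σ := by
  simp only [rmin, Finset.card_filter, Fin.sum_univ_add, forall_fin_add, Fin.lt_def,
    directSum_castAdd, directSum_natAdd, Fin.val_castAdd, Fin.val_natAdd]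
  congr 1
  · refine Finset.sum_congr rfl fun i _ => if_congr ⟨fun h => h.1, fun h => ⟨h, ?_⟩⟩ rfl rfl
    intro j hj
    have := (π i).isLt
    omega
  · refine Finset.sum_congr rfl fun i _ => if_congr ⟨fun h j hj => ?_, fun h => ⟨?_, ?_⟩⟩ rfl rfl
    · have := h.2 j (by omega)
      omega
    · intro j _
      omega
    · intro j hj
      have := h j (by omega)
      omega

theorem rmax_directSum (hn : 0 < n) : rmax (directSum π σ) = rmax σ := by
  simp only [rmax, Finset.card_filter, Fin.sum_univ_add, forall_fin_add, Fin.lt_def,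
    directSum_castAdd, directSum_natAdd, Fin.val_castAdd, Fin.val_natAdd]
  rw [Finset.sum_eq_zero, zero_add]
  · refine Finset.sum_congr rfl fun i _ => if_congr ⟨fun h j hj => ?_, fun h => ⟨?_, ?_⟩⟩ rfl rfl
    · have := h.2 j (by omega)
      omega
    · intro j _
      omega
    · intro j hj
      have := h j (by omega)
      omega
  · intro i _
    refine if_neg fun h => ?_
    have := h.2 ⟨0, hn⟩ (by omega)
    omega

theorem lmin_directSum (hm : 0 < m) : lmin (directSum π σ) = lmin π := by
  simp only [lmin, Finset.card_filter, Fin.sum_univ_add, forall_fin_add, Fin.lt_def,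
    directSum_castAdd, directSum_natAdd, Fin.val_castAdd, Fin.val_natAdd]
  rw [add_eq_left.2]
  · refine Finset.sum_congr rfl fun i _ => if_congr ⟨fun h => h.1, fun h => ⟨h, ?_⟩⟩ rfl rfl
    intro j hj
    omega
  · refine Finset.sum_eq_zero fun i _ => if_neg fun h => ?_
    have := h.1 ⟨0, hm⟩ (by simp; omega)
    have := (π ⟨0, hm⟩).isLt
    omega

end DirectSum

theorem directSum_injective {m n : ℕ} {π π' : Perm (Fin m)} {σ σ' : Perm (Fin n)}
    (h : directSum π σ = directSum π' σ') : π = π' ∧ σ = σ' := by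
  constructor
  · ext i
    rw [← directSum_castAdd π σ, h, directSum_castAdd]
  · ext i
    have := directSum_natAdd π σ i
    rw [h, directSum_natAdd] at this
    omega

/-! ### Reversal -/

/-- The reversal of a permutation. -/
def reverse {n : ℕ} (π : Perm (Fin n)) : Perm (Fin n) := Fin.revPerm.trans π

theorem reverse_apply {n : ℕ} (π : Perm (Fin n)) (i : Fin n) : reverse π i = π i.rev := rfl

@[simp]
theorem reverse_reverse {n : ℕ} (π : Perm (Fin n)) : reverse (reverse π) = π := by
  ext i
  simp [reverse_apply]

theorem lmax_reverse {n : ℕ} (π : Perm (Fin n)) : lmax (reverse π) = rmax π := by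
  refine Finset.card_equiv Fin.revPerm fun i => ?_
  rw [Finset.mem_filter, Finset.mem_filter]
  simp only [Finset.mem_univ, true_and, reverse_apply, Fin.revPerm_apply]
  refine ⟨fun h j hj => ?_, fun h j hj => h _ (Fin.rev_lt_rev.2 hj)⟩
  simpa using h j.rev (Fin.rev_lt_iff.1 (by simpa using hj))

theorem lmin_reverse {n : ℕ} (π : Perm (Fin n)) : lmin (reverse π) = rmin π := by
  refine Finset.card_equiv Fin.revPerm fun i => ?_
  rw [Finset.mem_filter, Finset.mem_filter]
  simp only [Finset.mem_univ, true_and, reverse_apply, Fin.revPerm_apply]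
  refine ⟨fun h j hj => ?_, fun h j hj => h _ (Fin.rev_lt_rev.2 hj)⟩
  simpa using h j.rev (Fin.rev_lt_iff.1 (by simpa using hj))

theorem rmax_reverse {n : ℕ} (π : Perm (Fin n)) : rmax (reverse π) = lmax π := by
  rw [← lmax_reverse, reverse_reverse]

theorem rmin_reverse {n : ℕ} (π : Perm (Fin n)) : rmin (reverse π) = lmin π := by
  rw [← lmin_reverse, reverse_reverse]

/-! ### Structure of separable permutations -/

theorem IsSeparable.pos {n : ℕ} {π : Perm (Fin n)} (h : IsSeparable π) : 0 < n := by
  induction h <;> omega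

/-- Transports separability between types such as `Perm (Fin (n + m))` and `Perm (Fin (m + n))`. -/
theorem IsSeparable.of_val_eq {m n : ℕ} (hmn : m = n) {π : Perm (Fin m)} {σ : Perm (Fin n)}
    (h : ∀ (i : Fin m) (j : Fin n), (i : ℕ) = j → (π i : ℕ) = σ j) (hπ : IsSeparable π) : IsSeparable σ := by
  subst hmn
  have : π = σ := by
    ext i
    exact h i i rfl
  exact this ▸ hπ

/-- Reversing π ⊕ σ gives (reverse σ) ⊖ (reverse π), and likewise with ⊕ and ⊖ exchanged. -/
theorem IsSeparable.reverse {n : ℕ} {π : Perm (Fin n)} (h : IsSeparable π) :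
    IsSeparable (reverse π) := by
  induction h with
  | one => rw [Subsingleton.elim (SepPerm.reverse 1) (1 : Perm (Fin 1))]; exact IsSeparable.one
  | @sum m n π σ _ _ ihπ ihσ =>
    refine IsSeparable.of_val_eq (Nat.add_comm n m) (fun i j hij => ?_) (ihσ.skew ihπ)
    induction i using Fin.addCases with
    | left i =>
      have hj : j.rev = Fin.natAdd m i.rev := by
        ext
        simp only [Fin.val_rev, Fin.val_natAdd, Fin.val_castAdd] at hij ⊢
        omega
      rw [skewSum_castAdd, reverse_apply, reverse_apply, hj, directSum_natAdd]
    | right i =>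
      have hj : j.rev = Fin.castAdd n i.rev := by
        ext
        simp only [Fin.val_rev, Fin.val_natAdd, Fin.val_castAdd] at hij ⊢
        omega
      rw [skewSum_natAdd, reverse_apply, reverse_apply, hj, directSum_castAdd]
  | @skew m n π σ _ _ ihπ ihσ =>
    refine IsSeparable.of_val_eq (Nat.add_comm n m) (fun i j hij => ?_) (ihσ.sum ihπ)
    induction i using Fin.addCases with
    | left i =>
      have hj : j.rev = Fin.natAdd m i.rev := by
        ext
        simp only [Fin.val_rev, Fin.val_natAdd, Fin.val_castAdd] at hij ⊢
        omega
      rw [directSum_castAdd, reverse_apply, reverse_apply, hj, skewSum_natAdd]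
    | right i =>
      have hj : j.rev = Fin.castAdd n i.rev := by
        ext
        simp only [Fin.val_rev, Fin.val_natAdd, Fin.val_castAdd] at hij ⊢
        omega
      rw [directSum_natAdd, reverse_apply, reverse_apply, hj, skewSum_castAdd]

theorem isSeparable_reverse_iff {n : ℕ} {π : Perm (Fin n)} :
    IsSeparable (reverse π) ↔ IsSeparable π :=
  ⟨fun h => reverse_reverse π ▸ h.reverse, fun h => h.reverse⟩

theorem isReducible_iff {n : ℕ} {π : Perm (Fin n)} :
    IsReducible π ↔ ∃ k : ℕ, 0 < k ∧ k < n ∧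
      ∀ i j : Fin n, (i : ℕ) < k → k ≤ (j : ℕ) → π i < π j := by
  unfold IsReducible IsIrreducible
  constructor
  · rintro ⟨hn, h⟩
    by_contra h'
    exact h ⟨hn, h'⟩
  · rintro ⟨k, hk, hkn, h⟩
    exact ⟨by omega, fun h' => h'.2 ⟨k, hk, hkn, h⟩⟩

theorem directSum_lt_directSum {m n : ℕ} (π : Perm (Fin m)) (σ : Perm (Fin n))
    (i j : Fin (m + n)) (hi : (i : ℕ) < m) (hj : m ≤ (j : ℕ)) :
    directSum π σ i < directSum π σ j := by
  induction i using Fin.addCases with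
  | right i => simp only [Fin.val_natAdd] at hi; omega
  | left i =>
    induction j using Fin.addCases with
    | left j => simp only [Fin.val_castAdd] at hj; omega
    | right j =>
      rw [Fin.lt_def, directSum_castAdd, directSum_natAdd]
      have := (π i).isLt
      omega

theorem isReducible_directSum {m n : ℕ} (hm : 0 < m) (hn : 0 < n) (π : Perm (Fin m))
    (σ : Perm (Fin n)) : IsReducible (directSum π σ) :=
  isReducible_iff.2 ⟨m, hm, by omega, directSum_lt_directSum π σ⟩

theorem skewSum_lt_skewSum {m n : ℕ} (π : Perm (Fin m)) (σ : Perm (Fin n))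
    (i j : Fin (m + n)) (hi : (i : ℕ) < m) (hj : m ≤ (j : ℕ)) :
    skewSum π σ j < skewSum π σ i := by
  induction i using Fin.addCases with
  | right i => simp only [Fin.val_natAdd] at hi; omega
  | left i =>
    induction j using Fin.addCases with
    | left j => simp only [Fin.val_castAdd] at hj; omega
    | right j =>
      rw [Fin.lt_def, skewSum_castAdd, skewSum_natAdd]
      have := (σ j).isLt
      omega

theorem isReducible_reverse_skewSum {m n : ℕ} (hm : 0 < m) (hn : 0 < n) (π : Perm (Fin m))
    (σ : Perm (Fin n)) : IsReducible (reverse (skewSum π σ)) := by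
  refine isReducible_iff.2 ⟨n, hn, by omega, fun i j hi hj => ?_⟩
  rw [reverse_apply, reverse_apply]
  refine skewSum_lt_skewSum π σ _ _ ?_ ?_ <;> rw [Fin.val_rev] <;> omega

theorem IsReducible.one_lt {n : ℕ} {π : Perm (Fin n)} (h : IsReducible π) : 1 < n := by
  obtain ⟨k, hk, hkn, -⟩ := isReducible_iff.1 h
  omega

/-- A cut of `π` puts its first entry below its last; a cut of the reversal puts it above. -/
theorem isIrreducible_of_isReducible_reverse {n : ℕ} {π : Perm (Fin n)}
    (h : IsReducible (reverse π)) : IsIrreducible π := by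
  obtain ⟨k, hk, hkn, h⟩ := isReducible_iff.1 h
  refine ⟨by omega, fun ⟨l, hl, hln, h'⟩ => ?_⟩
  have h1 := h ⟨0, by omega⟩ ⟨n - 1, by omega⟩ hk (by simp only; omega)
  have h2 := h' ⟨0, by omega⟩ ⟨n - 1, by omega⟩ hl (by simp only; omega)
  have e1 : Fin.rev ⟨0, by omega⟩ = (⟨n - 1, by omega⟩ : Fin n) := by
    ext
    simp only [Fin.val_rev]
  -- Going back through `e1` turns the reversal of the last position into a double reversal of
  -- position 0.
  rw [reverse_apply, reverse_apply, e1, ← e1, Fin.rev_rev, e1] at h1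
  exact lt_asymm h1 h2

theorem isIrreducible_one (π : Perm (Fin 1)) : IsIrreducible π :=
  ⟨one_pos, fun ⟨k, hk, hk1, _⟩ => by omega⟩

/-- The outermost operation is ⊕, which makes `π` reducible, or ⊖, which makes its reversal
reducible. -/
theorem IsSeparable.isIrreducible_iff {n : ℕ} {π : Perm (Fin n)} (hπ : IsSeparable π)
    (hn : n ≠ 1) : IsIrreducible π ↔ IsReducible (SepPerm.reverse π) := by
  refine ⟨fun h => ?_, isIrreducible_of_isReducible_reverse⟩
  cases hπ with
  | one => exact absurd rfl hn
  | sum hπ hσ => exact absurd h (isReducible_directSum hπ.pos hσ.pos _ _).2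
  | skew hπ hσ => exact isReducible_reverse_skewSum hπ.pos hσ.pos _ _

/-- `π` is, up to an identification of lengths, the direct sum of `α` and `β`. -/
def IsDirectSum {n k l : ℕ} (π : Perm (Fin n)) (α : Perm (Fin k)) (β : Perm (Fin l)) : Prop :=
  k + l = n ∧ ∀ (i : Fin (k + l)) (j : Fin n), (i : ℕ) = j → (directSum α β i : ℕ) = π j

theorem isDirectSum_iff {k l : ℕ} {π : Perm (Fin (k + l))} {α : Perm (Fin k)}
    {β : Perm (Fin l)} : IsDirectSum π α β ↔ directSum α β = π := by
  constructor
  · rintro ⟨-, h⟩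
    ext i
    exact h i i rfl
  · rintro rfl
    refine ⟨rfl, fun i j h => ?_⟩
    rw [Fin.ext h]

theorem isDirectSum_assoc {m n k l : ℕ} (π : Perm (Fin m)) {σ : Perm (Fin n)}
    {α : Perm (Fin k)} {β : Perm (Fin l)} (h : IsDirectSum σ α β) :
    IsDirectSum (directSum π σ) (directSum π α) β := by
  obtain ⟨rfl, -⟩ := id h
  obtain rfl := isDirectSum_iff.1 h
  refine ⟨by omega, fun i j hij => ?_⟩
  induction i using Fin.addCases with
  | left i =>
    rw [directSum_castAdd]
    induction i using Fin.addCases with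
    | left i =>
      have : j = Fin.castAdd _ i := Fin.ext (by simpa using hij.symm)
      rw [this, directSum_castAdd, directSum_castAdd]
    | right i =>
      have : j = Fin.natAdd _ (Fin.castAdd _ i) := Fin.ext (by simpa using hij.symm)
      rw [this, directSum_natAdd, directSum_natAdd, directSum_castAdd]
  | right i =>
    have : j = Fin.natAdd _ (Fin.natAdd _ i) := Fin.ext (by simp at hij ⊢; omega)
    rw [this, directSum_natAdd, directSum_natAdd, directSum_natAdd]
    omega

/-- If the right summand splits further as α ⊕ β, reassociate: π ⊕ (α ⊕ β) = (π ⊕ α) ⊕ β. -/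
theorem IsSeparable.exists_isDirectSum {n : ℕ} {π : Perm (Fin n)} (hπ : IsSeparable π) :
    IsIrreducible π ∨ ∃ (k l : ℕ) (α : Perm (Fin k)) (β : Perm (Fin l)),
      IsDirectSum π α β ∧ IsSeparable α ∧ IsSeparable β ∧ IsIrreducible β := by
  induction hπ with
  | one => exact Or.inl (isIrreducible_one _)
  | skew hπ hσ _ _ =>
    exact Or.inl (isIrreducible_of_isReducible_reverse
      (isReducible_reverse_skewSum hπ.pos hσ.pos _ _))
  | @sum m n π σ hπ hσ _ ih =>
    right
    rcases ih with ih | ⟨k, l, α, β, h, hα, hβ, hβ'⟩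
    · exact ⟨m, n, π, σ, isDirectSum_iff.2 rfl, hπ, hσ, ih⟩
    · exact ⟨m + k, l, directSum π α, β, isDirectSum_assoc π h, hπ.sum hα, hβ, hβ'⟩

/-- A cut of a direct sum with irreducible second summand lies inside the first one. -/
theorem IsDirectSum.le_of_irreducible {n k l k' l' : ℕ} {π : Perm (Fin n)} {α : Perm (Fin k)}
    {β : Perm (Fin l)} {α' : Perm (Fin k')} {β' : Perm (Fin l')} (h : IsDirectSum π α β)
    (h' : IsDirectSum π α' β') (hβ : IsIrreducible β) (hl' : 0 < l') : k' ≤ k := by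
  obtain ⟨rfl, -⟩ := id h
  obtain rfl := isDirectSum_iff.1 h
  obtain ⟨hn, h'⟩ := h'
  by_contra! hk
  -- A cut at k' > k would cut `β` after its first k' - k entries.
  refine hβ.2 ⟨k' - k, by omega, by omega, fun i j hi hj => ?_⟩
  have := directSum_lt_directSum α' β' ⟨k + i, by omega⟩ ⟨k + j, by omega⟩
    (by simp only; omega) (by simp only; omega)
  rw [Fin.lt_def, h' _ (Fin.natAdd k i) rfl, h' _ (Fin.natAdd k j) rfl, directSum_natAdd,
    directSum_natAdd] at this
  rw [Fin.lt_def]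
  omega

end SepPerm
namespace SepPerm

open Equiv

/-! ### Generating functions as power series -/

noncomputable section

/-- The monomial of the four statistics of a permutation. -/
def weight {n : ℕ} (a b c d : Coef) (π : Perm (Fin n)) : Coef :=
  a ^ lmax π * b ^ rmax π * c ^ lmin π * d ^ rmin π

open scoped Classical in
/-- The power series of which `genFun` is the image in the field of fractions. -/
def genSeries (P : ∀ {n : ℕ}, Perm (Fin n) → Prop) (a b c d : Coef) : PowerSeries Coef :=
  PowerSeries.mk fun n => ∑ π ∈ Finset.univ.filter (fun π : Perm (Fin n) => P π), weight a b c d π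

/-- The power series of separable permutations. -/
def sepSeries (a b c d : Coef) : PowerSeries Coef :=
  genSeries (fun π => IsSeparable π) a b c d

/-- The power series of irreducible separable permutations. -/
def irrSeries (a b c d : Coef) : PowerSeries Coef :=
  genSeries (fun π => IsSeparable π ∧ IsIrreducible π) a b c d

/-- The power series of reducible separable permutations. -/
def redSeries (a b c d : Coef) : PowerSeries Coef :=
  genSeries (fun π => IsSeparable π ∧ IsReducible π) a b c d

theorem sepGF_eq (a b c d : Coef) : sepGF a b c d = emb (sepSeries a b c d) := rfl

theorem irrGF_eq (a b c d : Coef) : irrGF a b c d = emb (irrSeries a b c d) := rfl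

theorem redGF_eq (a b c d : Coef) : redGF a b c d = emb (redSeries a b c d) := rfl

theorem weight_reverse {n : ℕ} (a b c d : Coef) (π : Perm (Fin n)) :
    weight a b c d (reverse π) = weight b a d c π := by
  rw [weight, weight, lmax_reverse, rmax_reverse, lmin_reverse, rmin_reverse]
  ring

theorem weight_directSum {m n : ℕ} (hm : 0 < m) (hn : 0 < n) (a b c d : Coef) (π : Perm (Fin m))
    (σ : Perm (Fin n)) :
    weight a b c d (directSum π σ) = weight a 1 c d π * weight a b 1 d σ := by
  rw [weight, weight, weight, lmax_directSum, rmax_directSum _ _ hn, lmin_directSum _ _ hm,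
    rmin_directSum]
  ring

theorem weight_one (a b c d : Coef) : weight a b c d (1 : Perm (Fin 1)) = a * b * c * d := by
  simp [weight, lmax, rmax, lmin, rmin]

theorem constantCoeff_sepSeries (a b c d : Coef) :
    PowerSeries.constantCoeff (sepSeries a b c d) = 0 := by
  classical
  rw [← PowerSeries.coeff_zero_eq_constantCoeff_apply, sepSeries, genSeries, PowerSeries.coeff_mk]
  refine Finset.sum_eq_zero fun π hπ => ?_
  exact absurd (Finset.mem_filter.1 hπ).2.pos (lt_irrefl 0)

theorem sepSeries_eq_add (a b c d : Coef) :
    sepSeries a b c d = irrSeries a b c d + redSeries a b c d := by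
  classical
  ext1 n
  simp only [sepSeries, irrSeries, redSeries, genSeries, map_add, PowerSeries.coeff_mk]
  rw [← Finset.sum_union]
  · refine Finset.sum_congr ?_ fun _ _ => rfl
    ext π
    rw [Finset.mem_union, Finset.mem_filter, Finset.mem_filter, Finset.mem_filter, IsReducible]
    have hu := Finset.mem_univ π
    have : IsSeparable π → 0 < n := fun h => h.pos
    tauto
  · rw [Finset.disjoint_left]
    intro π h1 h2
    exact (Finset.mem_filter.1 h2).2.2.2 (Finset.mem_filter.1 h1).2.2

theorem sepSeries_symm (a b c d : Coef) : sepSeries a b c d = sepSeries b a d c := by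
  classical
  ext1 n
  simp only [sepSeries, genSeries, PowerSeries.coeff_mk]
  refine Finset.sum_nbij' reverse reverse ?_ ?_ ?_ ?_ ?_
  · intro π hπ
    simpa [isSeparable_reverse_iff] using hπ
  · intro π hπ
    simpa [isSeparable_reverse_iff] using hπ
  · intro π _
    exact reverse_reverse π
  · intro π _
    exact reverse_reverse π
  · intro π _
    rw [weight_reverse]

/-- Reversal is a bijection between irreducible and reducible separable permutations of each length
other than 1; the linear term is the permutation of length 1. -/
theorem irrSeries_eq (a b c d : Coef) :
    irrSeries a b c d = PowerSeries.C (a * b * c * d) * PowerSeries.X + redSeries b a d c := by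
  classical
  ext1 n
  simp only [irrSeries, redSeries, genSeries, map_add, PowerSeries.coeff_mk,
    PowerSeries.coeff_C_mul, PowerSeries.coeff_X]
  by_cases hn : n = 1
  · subst hn
    rw [if_pos rfl, Finset.sum_eq_single_of_mem (1 : Perm (Fin 1)), weight_one, mul_one,
      left_eq_add]
    · refine Finset.sum_eq_zero fun π hπ => ?_
      exact absurd (Finset.mem_filter.1 hπ).2.2.one_lt (lt_irrefl 1)
    · exact Finset.mem_filter.2 ⟨Finset.mem_univ _, IsSeparable.one, isIrreducible_one _⟩
    · exact fun π _ h => absurd (Subsingleton.elim _ _) h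
  · rw [if_neg hn, mul_zero, zero_add]
    refine Finset.sum_nbij' reverse reverse ?_ ?_ ?_ ?_ ?_
    · intro π hπ
      have h := (Finset.mem_filter.1 hπ).2
      exact Finset.mem_filter.2 ⟨Finset.mem_univ _, h.1.reverse, (h.1.isIrreducible_iff hn).1 h.2⟩
    · intro π hπ
      have h := (Finset.mem_filter.1 hπ).2
      refine Finset.mem_filter.2 ⟨Finset.mem_univ _, h.1.reverse, ?_⟩
      rw [h.1.reverse.isIrreducible_iff hn, reverse_reverse]
      exact h.2
    · intro π _
      exact reverse_reverse π
    · intro π _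
      exact reverse_reverse π
    · intro π _
      rw [weight_reverse]

/-- Every reducible separable permutation is, in a unique way, the direct sum of a separable
permutation and an irreducible separable one. -/
theorem redSeries_eq_mul (a b c d : Coef) :
    redSeries a b c d = sepSeries a 1 c d * irrSeries a b 1 d := by
  classical
  ext1 n
  rw [PowerSeries.coeff_mul]
  simp only [sepSeries, irrSeries, redSeries, genSeries, PowerSeries.coeff_mk]
  -- Reducible permutations are sorted by the lengths of the two summands; `le_of_irreducible`,
  -- applied in both directions, makes the classes disjoint.
  let T : ℕ × ℕ → Finset (Perm (Fin n)) := fun p => Finset.univ.filter fun π =>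
    ∃ (α : Perm (Fin p.1)) (β : Perm (Fin p.2)),
      IsDirectSum π α β ∧ IsSeparable α ∧ IsSeparable β ∧ IsIrreducible β
  have hT : Finset.univ.filter (fun π : Perm (Fin n) => IsSeparable π ∧ IsReducible π) =
      (Finset.HasAntidiagonal.antidiagonal n).biUnion T := by
    ext π
    simp only [T, Finset.mem_filter, Finset.mem_univ, true_and, Finset.mem_biUnion,
      Finset.HasAntidiagonal.mem_antidiagonal]
    constructor
    · rintro ⟨hπ, hπ'⟩
      obtain ⟨k, l, α, β, h⟩ := hπ.exists_isDirectSum.resolve_left hπ'.2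
      exact ⟨(k, l), h.1.1, α, β, h⟩
    · rintro ⟨⟨k, l⟩, hkl, α, β, h, hα, hβ, -⟩
      obtain rfl : k + l = n := hkl
      obtain rfl := isDirectSum_iff.1 h
      exact ⟨hα.sum hβ, isReducible_directSum hα.pos hβ.pos _ _⟩
  rw [hT, Finset.sum_biUnion]
  · refine Finset.sum_congr rfl ?_
    rintro ⟨k, l⟩ hkl
    obtain rfl : k + l = n := Finset.HasAntidiagonal.mem_antidiagonal.1 hkl
    rw [Finset.sum_mul_sum, ← Finset.sum_product']
    symm
    refine Finset.sum_nbij (fun p => directSum p.1 p.2) ?_ ?_ ?_ ?_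
    · rintro ⟨α, β⟩ h
      simp only [Finset.mem_product, Finset.mem_filter, Finset.mem_univ, true_and] at h
      exact Finset.mem_filter.2 ⟨Finset.mem_univ _, α, β, isDirectSum_iff.2 rfl, h⟩
    · rintro ⟨α, β⟩ _ ⟨α', β'⟩ _ h
      exact Prod.ext (directSum_injective h).1 (directSum_injective h).2
    · intro π hπ
      obtain ⟨-, α, β, h, h'⟩ := Finset.mem_filter.1 hπ
      refine ⟨(α, β), ?_, isDirectSum_iff.1 h⟩
      simpa using h'
    · rintro ⟨α, β⟩ h
      simp only [Finset.mem_product, Finset.mem_filter, Finset.mem_univ, true_and] at h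
      rw [weight_directSum h.1.pos h.2.1.pos]
  · rintro ⟨k, l⟩ hkl ⟨k', l'⟩ hkl' hne
    rw [Function.onFun, Finset.disjoint_left]
    intro π hπ hπ'
    obtain ⟨-, α, β, h, hα, hβ, hβ'⟩ := Finset.mem_filter.1 hπ
    obtain ⟨-, α', β', h', hα', hγ, hγ'⟩ := Finset.mem_filter.1 hπ'
    have h1 := h.le_of_irreducible h' hβ' hγ.pos
    have h2 := h'.le_of_irreducible h hγ' hβ.pos
    have h3 := h.1
    have h4 := h'.1
    apply hne
    simp only at h1 h2 h3 h4
    ext <;> simp only <;> omega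

end

end SepPerm
namespace SepPerm

/-! ### Functional equations in the field of fractions -/

theorem emb_injective : Function.Injective emb :=
  IsFractionRing.injective (PowerSeries Coef) GFField

instance : CharZero GFField :=
  have := algebraRat.charZero (PowerSeries Coef)
  charZero_of_injective_algebraMap (R := PowerSeries Coef) emb_injective

theorem cst_one : cst 1 = 1 := by
  rw [cst, map_one, map_one]

theorem t_ne_zero : t ≠ 0 := by
  rw [t, Ne, map_eq_zero_iff emb emb_injective]
  exact PowerSeries.X_ne_zero

/-- Justifies dividing by 1 + S, 1 - S·S' and 1 - I below. -/
theorem one_sub_emb_ne_zero {F : PowerSeries Coef} (hF : PowerSeries.constantCoeff F = 0) :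
    1 - emb F ≠ 0 := by
  intro h
  rw [← map_one emb, ← map_sub, map_eq_zero_iff emb emb_injective] at h
  have h' := congrArg PowerSeries.constantCoeff h
  rw [map_sub, hF, map_one, map_zero, sub_zero] at h'
  exact one_ne_zero h'

theorem one_add_sepGF_ne_zero (a b c d : Coef) : 1 + sepGF a b c d ≠ 0 := by
  have := one_sub_emb_ne_zero (F := -sepSeries a b c d)
    (by rw [map_neg, constantCoeff_sepSeries, neg_zero])
  rwa [map_neg, sub_neg_eq_add] at this

theorem one_sub_sepGF_mul_sepGF_ne_zero (a b c d a' b' c' d' : Coef) :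
    1 - sepGF a b c d * sepGF a' b' c' d' ≠ 0 := by
  rw [sepGF_eq, sepGF_eq, ← map_mul]
  exact one_sub_emb_ne_zero (by rw [map_mul, constantCoeff_sepSeries, zero_mul])

theorem one_sub_irrGF_ne_zero (a b c d : Coef) : 1 - irrGF a b c d ≠ 0 := by
  rw [irrGF_eq]
  refine one_sub_emb_ne_zero ?_
  rw [irrSeries_eq, redSeries_eq_mul, map_add, map_mul, map_mul _ (sepSeries _ _ _ _),
    constantCoeff_sepSeries, PowerSeries.constantCoeff_X, mul_zero, zero_mul, add_zero]

theorem sepGF_eq_add (a b c d : Coef) : sepGF a b c d = irrGF a b c d + redGF a b c d := by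
  rw [sepGF_eq, sepSeries_eq_add, map_add, irrGF_eq, redGF_eq]

theorem redGF_eq_mul (a b c d : Coef) : redGF a b c d = sepGF a 1 c d * irrGF a b 1 d := by
  rw [redGF_eq, redSeries_eq_mul, map_mul, irrGF_eq, sepGF_eq]

theorem irrGF_reverse (a b c d : Coef) :
    irrGF b a d c = cst a * cst b * cst c * cst d * t + redGF a b c d := by
  simp only [irrGF_eq, irrSeries_eq, map_add, map_mul, cst, t, redGF_eq]
  ring

theorem sepGF_reverse (a b c d : Coef) : sepGF b a d c = sepGF a b c d := by
  rw [sepGF_eq, sepSeries_symm, sepGF_eq]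

/-- Reverse, decompose the resulting reducible permutations, then reverse both factors back. -/
theorem irrGF_eq_add_mul (a b c d : Coef) :
    irrGF a b c d = cst a * cst b * cst c * cst d * t +
      (cst a * cst b * cst c * t + redGF a b c 1) * sepGF 1 b c d := by
  have h := irrGF_reverse a b c 1
  rw [irrGF_reverse b a d c, redGF_eq_mul, h, sepGF_reverse, cst_one]
  ring

/-! ### A single statistic -/

/-- Eliminates I and R from S = I + R, R = S·I and I = t + R. -/
theorem sepGF_one_quadratic :
    sepGF 1 1 1 1 ^ 2 - sepGF 1 1 1 1 + t * sepGF 1 1 1 1 + t = 0 := by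
  have h0 := sepGF_eq_add 1 1 1 1
  have h1 := irrGF_eq_add_mul 1 1 1 1
  have h2 := redGF_eq_mul 1 1 1 1
  have h3 := one_add_sepGF_ne_zero 1 1 1 1
  rw [cst_one] at h1
  generalize sepGF 1 1 1 1 = c at *
  generalize irrGF 1 1 1 1 = i at *
  generalize redGF 1 1 1 1 = r at *
  have h4 : i - t - r = 0 := by
    apply mul_left_cancel₀ h3
    linear_combination h1 - h2
  linear_combination (c - 1) * h0 - 2 * h2 - (1 + c) * h4

/-- The quadratic equation satisfied by the generating function of a single statistic. -/
def IsSingle (z s : GFField) : Prop :=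
  sepGF 1 1 1 1 * s ^ 2 - (1 - z * t * (1 + sepGF 1 1 1 1)) * s +
    z * t * (1 + sepGF 1 1 1 1) = 0

theorem irrGF_one_mul :
    irrGF 1 1 1 1 * (1 + sepGF 1 1 1 1) = sepGF 1 1 1 1 := by
  linear_combination -sepGF_eq_add 1 1 1 1 - redGF_eq_mul 1 1 1 1

theorem add_redGF_one_mul :
    (t + redGF 1 1 1 1) * (1 + sepGF 1 1 1 1) = sepGF 1 1 1 1 := by
  have h := irrGF_eq_add_mul 1 1 1 1
  rw [cst_one] at h
  linear_combination -sepGF_eq_add 1 1 1 1 - h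

/-- For each statistic, I and R are eliminated from the same three equations, and the outcome is one
common quadratic. For `lmin` and `rmin` an unmarked factor also appears, removed by `irrGF_one_mul`
or `add_redGF_one_mul`. -/
theorem isSingle_lmax (z : Coef) : IsSingle (cst z) (sepGF z 1 1 1) := by
  have h0 := sepGF_eq_add z 1 1 1
  have h1 := irrGF_eq_add_mul z 1 1 1
  have h2 := redGF_eq_mul z 1 1 1
  rw [cst_one, h2] at h1
  rw [h2] at h0
  rw [IsSingle]
  linear_combination -(1 + sepGF z 1 1 1) * h1 + (sepGF 1 1 1 1 * sepGF z 1 1 1 - 1) * h0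

theorem isSingle_rmax (z : Coef) : IsSingle (cst z) (sepGF 1 z 1 1) := by
  have h0 := sepGF_eq_add 1 z 1 1
  have h1 := irrGF_eq_add_mul 1 z 1 1
  have h2 := redGF_eq_mul 1 z 1 1
  rw [cst_one] at h1
  rw [IsSingle]
  linear_combination -(1 + sepGF 1 z 1 1) * (h2 + sepGF 1 1 1 1 * h1) -
    (1 - sepGF 1 1 1 1 * sepGF 1 z 1 1) * (h0 + h1)

theorem isSingle_lmin (z : Coef) : IsSingle (cst z) (sepGF 1 1 z 1) := by
  have h0 := sepGF_eq_add 1 1 z 1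
  have h1 := irrGF_eq_add_mul 1 1 z 1
  have h2 := redGF_eq_mul 1 1 z 1
  rw [cst_one] at h1
  rw [IsSingle]
  linear_combination -(1 + sepGF 1 1 1 1) * (1 + sepGF 1 1 z 1) * h2 -
    (1 + sepGF 1 1 1 1) * (h0 + h1) -
    sepGF 1 1 z 1 * (1 + sepGF 1 1 z 1) * irrGF_one_mul

theorem isSingle_rmin (z : Coef) : IsSingle (cst z) (sepGF 1 1 1 z) := by
  have h0 := sepGF_eq_add 1 1 1 z
  have h1 := irrGF_eq_add_mul 1 1 1 z
  have h2 := redGF_eq_mul 1 1 1 z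
  rw [cst_one] at h1
  rw [IsSingle]
  linear_combination -(1 + sepGF 1 1 1 1) * (1 + sepGF 1 1 1 z) * h1 -
    (1 + sepGF 1 1 1 1) * (h0 + h2) -
    sepGF 1 1 1 z * (1 + sepGF 1 1 1 z) * add_redGF_one_mul

/-! ### Solving the quadratics by square roots of power series. -/

theorem smul_eq_C_mul (q : ℚ) (F : PowerSeries Coef) :
    q • F = algebraMap ℚ (PowerSeries Coef) q * F :=
  Algebra.smul_def q F

theorem emb_rat_smul (q : ℚ) (F : PowerSeries Coef) : emb (q • F) = (q : GFField) * emb F := by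
  rw [Algebra.smul_def, map_mul]
  congr 1
  rw [← RingHom.comp_apply]
  exact eq_ratCast _ q

theorem rootA_eq :
    rootA = 1 - PowerSeries.X - 2 * sepSeries 1 1 1 1 := by
  refine (eq_psqrt _ _ ?_ ?_).symm
  · rw [map_sub, map_sub, map_mul, constantCoeff_sepSeries]
    simp
  · apply emb_injective
    have h := sepGF_one_quadratic
    rw [sepGF_eq, t] at h
    simp only [map_pow, map_sub, map_mul, map_add, map_one, map_ofNat]
    linear_combination 4 * h

/-- The denominator of `S1` equals -4 times this element. -/
theorem sepGF_add_t_ne_zero : sepGF 1 1 1 1 + t ≠ 0 := by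
  intro h
  have h1 := sepGF_one_quadratic
  have h2 : t = 0 := by
    linear_combination (1 / 2 : GFField) * h1 - (1 / 2) * (sepGF 1 1 1 1 - 1) * h
  exact t_ne_zero h2

/-- The right side is the formula for `S1` solved for the root. Its square is the radicand by the
two quadratics, and constant term 1 fixes the sign. -/
theorem rootB_eq {z : Coef} {F : PowerSeries Coef} (hF : PowerSeries.constantCoeff F = 0)
    (h : IsSingle (cst z) (emb F)) :
    emb (rootB z) = 1 - (sepGF 1 1 1 1 + t) / 2 - t * cst z - (sepGF 1 1 1 1 + t) * emb F := by
  have hB : rootB z = 1 - (1 / 2 : ℚ) • (sepSeries 1 1 1 1 + PowerSeries.X) -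
      PowerSeries.X * PowerSeries.C z - (sepSeries 1 1 1 1 + PowerSeries.X) * F := by
    refine (eq_psqrt _ _ ?_ ?_).symm
    · simp [hF, constantCoeff_sepSeries, smul_eq_C_mul]
    · apply emb_injective
      -- With c = S(1,1,1,1), t equals c(1 - c)/(1 + c); the factor 1 + c clears this denominator.
      apply mul_left_cancel₀ (one_add_sepGF_ne_zero 1 1 1 1)
      have h1 := sepGF_one_quadratic
      rw [IsSingle] at h
      rw [rootA_eq]
      simp only [map_pow, map_sub, map_mul, map_add, map_one, map_ofNat, emb_rat_smul, map_neg]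
      rw [← sepGF_eq]
      change _ * (1 - _ * (_ + t) - t * cst z - (_ + t) * _) ^ 2 =
        _ * ((-(_ * (1 - t - _)) - t * cst z + _ * t + _) ^ 2 + (1 - t - _) - t - 1)
      push_cast
      linear_combination 2 * (t + sepGF 1 1 1 1) * h +
        (t + sepGF 1 1 1 1) * (emb F ^ 2 + emb F) * h1
  rw [hB]
  simp only [map_sub, map_mul, map_add, map_one, emb_rat_smul, ← sepGF_eq]
  change 1 - _ * (_ + t) - t * cst z - (_ + t) * _ = _
  push_cast
  ring

theorem IsSingle.eq_S1 {z : Coef} {F : PowerSeries Coef} (hF : PowerSeries.constantCoeff F = 0)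
    (h : IsSingle (cst z) (emb F)) : emb F = S1 z := by
  have hA : emb rootA = 1 - t - 2 * sepGF 1 1 1 1 := by
    rw [rootA_eq, sepGF_eq, t]
    simp only [map_sub, map_mul, map_one, map_ofNat]
  rw [S1, rootB_eq hF h, hA, eq_div_iff]
  · ring
  · intro h0
    apply sepGF_add_t_ne_zero
    linear_combination (-1 / 4 : GFField) * h0

theorem sepGF_lmax (z : Coef) : sepGF z 1 1 1 = S1 z :=
  IsSingle.eq_S1 (constantCoeff_sepSeries _ _ _ _) (isSingle_lmax z)

theorem sepGF_rmax (z : Coef) : sepGF 1 z 1 1 = S1 z :=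
  IsSingle.eq_S1 (constantCoeff_sepSeries _ _ _ _) (isSingle_rmax z)

theorem sepGF_lmin (z : Coef) : sepGF 1 1 z 1 = S1 z :=
  IsSingle.eq_S1 (constantCoeff_sepSeries _ _ _ _) (isSingle_lmin z)

theorem sepGF_rmin (z : Coef) : sepGF 1 1 1 z = S1 z :=
  IsSingle.eq_S1 (constantCoeff_sepSeries _ _ _ _) (isSingle_rmin z)

end SepPerm
namespace SepPerm

/-! ### Two and three statistics -/

theorem S1_add_one_ne_zero (z : Coef) : S1 z + 1 ≠ 0 := by
  rw [← sepGF_lmax, add_comm]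
  exact one_add_sepGF_ne_zero _ _ _ _

theorem one_sub_S1_mul_S1_ne_zero (a b : Coef) : 1 - S1 a * S1 b ≠ 0 := by
  rw [← sepGF_lmax, ← sepGF_lmax]
  exact one_sub_sepGF_mul_sepGF_ne_zero _ _ _ _ _ _ _ _

theorem isSingle_S1 (z : Coef) : IsSingle (cst z) (S1 z) :=
  sepGF_lmax z ▸ isSingle_lmax z

theorem irrGF_lmax (a : Coef) : irrGF a 1 1 1 = S1 a / (S1 a + 1) := by
  have h0 := sepGF_eq_add a 1 1 1
  rw [redGF_eq_mul, sepGF_lmax] at h0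
  rw [eq_div_iff (S1_add_one_ne_zero a)]
  linear_combination -h0

theorem irrGF_rmin (d : Coef) : irrGF 1 1 1 d = S1 d / (S1 d + 1) := by
  have h0 := sepGF_eq_add 1 1 1 d
  rw [redGF_eq_mul, sepGF_rmin] at h0
  rw [eq_div_iff (S1_add_one_ne_zero d)]
  linear_combination -h0

theorem add_redGF_rmax (b : Coef) : cst b * t + redGF 1 b 1 1 = S1 b / (S1 b + 1) := by
  have h0 := sepGF_eq_add 1 b 1 1
  rw [irrGF_eq_add_mul, sepGF_rmax, cst_one] at h0
  rw [eq_div_iff (S1_add_one_ne_zero b)]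
  linear_combination -h0

theorem add_redGF_lmin (c : Coef) : cst c * t + redGF 1 1 c 1 = S1 c / (S1 c + 1) := by
  have h0 := sepGF_eq_add 1 1 c 1
  rw [irrGF_eq_add_mul, sepGF_lmin, cst_one] at h0
  rw [eq_div_iff (S1_add_one_ne_zero c)]
  linear_combination -h0

/-- With the single-statistic series known, S = I + R is linear in this unknown. -/
theorem sepGF_lmax_lmin (a c : Coef) :
    sepGF a 1 c 1 = cst a * cst c * t * (S1 a + 1) * (S1 c + 1) / (1 - S1 a * S1 c) := by
  have h0 := sepGF_eq_add a 1 c 1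
  rw [irrGF_eq_add_mul, redGF_eq_mul, irrGF_lmax, sepGF_lmin, cst_one] at h0
  have ha := S1_add_one_ne_zero a
  rw [eq_div_iff (one_sub_S1_mul_S1_ne_zero a c)]
  field_simp at h0
  linear_combination h0

theorem irrGF_lmax_rmax (a b : Coef) :
    irrGF a b 1 1 = cst a * cst b * t * (S1 b + 1) / (1 - S1 a * S1 b) := by
  have h0 := irrGF_eq_add_mul a b 1 1
  rw [redGF_eq_mul, sepGF_lmax, sepGF_rmax, cst_one] at h0
  rw [eq_div_iff (one_sub_S1_mul_S1_ne_zero a b)]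
  linear_combination h0

theorem sepGF_eq_irrGF_mul (b d : Coef) : sepGF 1 b 1 d = (S1 d + 1) * irrGF 1 b 1 d := by
  rw [sepGF_eq_add, redGF_eq_mul, sepGF_rmin]
  ring

theorem irrGF_rmax_rmin (b d : Coef) :
    irrGF 1 b 1 d = cst b * cst d * t * (S1 b + 1) / (1 - S1 b * S1 d) := by
  have h0 := irrGF_eq_add_mul 1 b 1 d
  simp only [cst_one, one_mul, mul_one] at h0
  rw [add_redGF_rmax, sepGF_eq_irrGF_mul] at h0
  have hb := S1_add_one_ne_zero b
  rw [eq_div_iff (one_sub_S1_mul_S1_ne_zero b d)]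
  field_simp at h0
  linear_combination h0

theorem sepGF_lmin_rmin (c d : Coef) :
    sepGF 1 1 c d = cst c * cst d * t * (S1 c + 1) * (S1 d + 1) / (1 - S1 c * S1 d) := by
  have h0 := sepGF_eq_add 1 1 c d
  rw [irrGF_eq_add_mul, redGF_eq_mul 1 1 c d, irrGF_rmin, cst_one, one_mul, one_mul,
    add_redGF_lmin] at h0
  have hc := S1_add_one_ne_zero c
  have hd := S1_add_one_ne_zero d
  rw [eq_div_iff (one_sub_S1_mul_S1_ne_zero c d)]
  field_simp at h0
  linear_combination h0

/-! ### The function `E` and the three-statistic series. -/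

theorem add_redGF_eq_E (a b c : Coef) :
    cst a * cst b * cst c * t + redGF a b c 1 = E a b c := by
  rw [redGF_eq_mul, sepGF_lmax_lmin, irrGF_lmax_rmax, E, div_mul_div_comm]
  ring

theorem irrGF_eq_E (a b d : Coef) : irrGF a b 1 d = E b a d := by
  rw [irrGF_eq_add_mul, redGF_eq_mul, sepGF_lmax, irrGF_lmax_rmax, sepGF_eq_irrGF_mul,
    irrGF_rmax_rmin, cst_one, E, mul_comm (S1 b) (S1 a)]
  have h1 := one_sub_S1_mul_S1_ne_zero a b
  have h2 := one_sub_S1_mul_S1_ne_zero b d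
  field_simp
  ring

/-- Explains the denominator of `S3`: it is 1 - I(a,1,1,d). -/
theorem irrGF_lmax_rmin (a d : Coef) : irrGF a 1 1 d = A d a + t * cst d * cst a := by
  rw [irrGF_eq_add_mul, redGF_eq_mul, irrGF_lmax, sepGF_lmax, sepGF_rmin, cst_one, A]
  ring

theorem add_redGF_lmax_lmin (a c : Coef) :
    cst a * cst c * t + redGF a 1 c 1 =
      cst a * cst c * t * (S1 a + 1) / (1 - S1 a * S1 c) := by
  have ha := S1_add_one_ne_zero a
  have h := one_sub_S1_mul_S1_ne_zero a c
  rw [redGF_eq_mul, sepGF_lmax_lmin, irrGF_lmax]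
  generalize S1 a = p at *
  generalize S1 c = q at *
  field_simp
  ring

/-- Since R(a,1,c,d) = S(a,1,c,d) I(a,1,1,d), the quotient I(a,1,c,d) / (1 - I(a,1,1,d)) is
S(a,1,c,d), and its numerator is E(c,d,a). -/
theorem sepGF_eq_S3 (a c d : Coef) : sepGF a 1 c d = S3 c d a := by
  have h0 := sepGF_eq_add a 1 c d
  rw [redGF_eq_mul, irrGF_eq_add_mul a 1 c d, cst_one, mul_one, add_redGF_lmax_lmin,
    sepGF_lmin_rmin, irrGF_lmax_rmin] at h0
  have hne := one_sub_irrGF_ne_zero a 1 1 d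
  rw [irrGF_lmax_rmin] at hne
  rw [S3, sub_sub, eq_div_iff hne, E]
  rw [div_mul_div_comm, mul_comm (S1 a) (S1 c)] at h0
  linear_combination h0

theorem E_symm (a b c : Coef) : E a b c = E a c b := by
  rw [E, E]
  ring

/-- Combinatorially this is inversion of permutations, which exchanges `lmax` and `rmin`; here it
follows from the quadratics for `S1 b` and `S1 c`. -/
theorem A_symm (b c : Coef) : A b c = A c b := by
  have hb := isSingle_S1 b
  have hc := isSingle_S1 c
  have hb' := S1_add_one_ne_zero b
  have hc' := S1_add_one_ne_zero c
  apply mul_left_cancel₀ (one_add_sepGF_ne_zero 1 1 1 1)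
  rw [IsSingle] at hb hc
  rw [A, A]
  field_simp
  linear_combination S1 b * (S1 b + 1) * hc - S1 c * (S1 c + 1) * hb

theorem S3_symm (a b c : Coef) : S3 a b c = S3 a c b := by
  rw [S3, S3, E_symm, A_symm, mul_right_comm t]

end SepPerm

open SepPerm in
theorem theorem7 :
    -- all separable permutations
    (sepGF x y u v = cst x * cst y * cst u * cst v * t
        + E x y u * sepGF 1 y u v + E y x v * sepGF x 1 u v) ∧
    -- irreducible separable permutations
    (irrGF x y u v = cst x * cst y * cst u * cst v * t + E x y u * sepGF 1 y u v) ∧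
    -- reducible separable permutations
    (redGF x y u v = E y x v * sepGF x 1 u v) ∧
    -- the two generating functions for three statistics, in closed form
    (sepGF 1 y u v = S3 v y u ∧ sepGF x 1 u v = S3 u v x) ∧
    -- the generating functions for one statistic, in closed form
    (sepGF x 1 1 1 = S1 x ∧ sepGF 1 y 1 1 = S1 y ∧
      sepGF 1 1 u 1 = S1 u ∧ sepGF 1 1 1 v = S1 v) := by
  have hI : irrGF x y u v = cst x * cst y * cst u * cst v * t + E x y u * sepGF 1 y u v := by
    rw [irrGF_eq_add_mul, add_redGF_eq_E]
  have hR : redGF x y u v = E y x v * sepGF x 1 u v := by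
    rw [redGF_eq_mul, irrGF_eq_E, mul_comm]
  refine ⟨by rw [sepGF_eq_add, hI, hR], hI, hR, ⟨?_, sepGF_eq_S3 x u v⟩, sepGF_lmax x,
    sepGF_rmax y, sepGF_lmin u, sepGF_rmin v⟩
  -- Reversal yields `S3 v u y`; the symmetry of `S3` puts the arguments in the stated order.
  rw [← sepGF_reverse, sepGF_eq_S3, S3_symm]
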